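/- Let $m,n\ge 1$ and $1\le r\le \min(m,n)$, and let $\sigma_1(M)\ge\sigma_2(M)\ge\cdots\ge\sigma_{m\wedge n}(M)\ge 0$ denote the singular values of $M\in\mathbb R^{m\times n}$. For $q\in[1,\infty]$ let $\|M\|_q=\big(\sum_{i=1}^{m\wedge n}\sigma_i(M)^q\big)^{1/q}$ be the Schatten-$q$ norm (with $\|M\|_\infty=\sigma_1(M)$). For a singular value decomposition $M=\sum_{i=1}^{m\wedge n}\sigma_i(M)u_iv_i^\top$ let $M_{\max(r)}=\sum_{i=1}^{r}\sigma_i(M)u_iv_i^\top$ be the best rank-$r$ approximation of $M$. For $U_1,U_2\in\mathbb R^{p\times r}$ with orthonormal columns let $\sin\Theta(U_1,U_2)=\mathrm{diag}\big(\sin\cos^{-1}\sigma_1(U_1^\top U_2),\dots,\sin\cos^{-1}\sigma_r(U_1^\top U_2)\big)$. Let $B=A+Z$ with $A,B,Z\in\mathbb R^{m\times n}$ and $A$ of rank $r$. Let $U\in\mathbb R^{m\times r}$, $V\in\mathbb R^{n\times r}$ consist of the first $r$ left and right singular vectors in a singular value decomposition of $A$, and let $\widehat U\in\mathbb R^{m\times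 r}$, $\widehat V\in\mathbb R^{n\times r}$ consist of the first $r$ left and right singular vectors in a singular value decomposition of $B$ (with singular values in decreasing order; any choice is allowed when it is not unique). Then for every $q\in[1,\infty]$, $$\max\left\{\|\sin\Theta(\widehat U,U)\|_q,\ \|\sin\Theta(\widehat V,V)\|_q\right\}\le\frac{2\,\|Z_{\max(r)}\|_q}{\sigma_r(A)}.$$ -/

import Mathlib

open scoped ENNReal Matrix

/-- The singular values of a real matrix, in decreasing order and indexed from `0`:
`matSingularValue M k` is `σ_{k+1}(M)` (and it is `0` for `k ≥ min m n`). -/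
noncomputable def matSingularValue {m n : ℕ} (M : Matrix (Fin m) (Fin n) ℝ) (k : ℕ) : ℝ :=
  (Matrix.toEuclideanLin M).singularValues k

/-- The Schatten-`q` norm, `q ∈ [1, ∞]`: the `ℓ^q` norm of the `min m n` singular values;
for `q = ∞` it is the largest singular value. -/
noncomputable def schattenNorm {m n : ℕ} (q : ℝ≥0∞) (M : Matrix (Fin m) (Fin n) ℝ) : ℝ :=
  if q = ∞ then matSingularValue M 0
  else (∑ k ∈ Finset.range (min m n), matSingularValue M k ^ q.toReal) ^ (1 / q.toReal)

/-- The rectangular (pseudo) diagonal `m × n` matrix with diagonal entries `s 0, s 1, …`. -/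
def pseudoDiag (m n : ℕ) (s : ℕ → ℝ) : Matrix (Fin m) (Fin n) ℝ :=
  Matrix.of fun i j => if (i : ℕ) = (j : ℕ) then s i else 0

/-- `M = P Σ Qᵀ` is a (full) singular value decomposition: `P` and `Q` are orthogonal and `Σ` is the
pseudo diagonal matrix of the decreasing singular values of `M`. -/
structure IsSVD {m n : ℕ} (M : Matrix (Fin m) (Fin n) ℝ)
    (P : Matrix (Fin m) (Fin m) ℝ) (Q : Matrix (Fin n) (Fin n) ℝ) : Prop where
  left_orthogonal : P ∈ Matrix.orthogonalGroup (Fin m) ℝ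
  right_orthogonal : Q ∈ Matrix.orthogonalGroup (Fin n) ℝ
  eq_mul : M = P * pseudoDiag m n (matSingularValue M) * Qᵀ

/-- `U` and `V` consist of the first `r` left and right singular vectors in some singular value
decomposition `M = [U U⊥] Σ [V V⊥]ᵀ`. -/
def IsLeadingSingularVectors {m n : ℕ} (r : ℕ) (M : Matrix (Fin m) (Fin n) ℝ)
    (U : Matrix (Fin m) (Fin r) ℝ) (V : Matrix (Fin n) (Fin r) ℝ) : Prop :=
  ∃ (hm : r ≤ m) (hn : r ≤ n) (P : Matrix (Fin m) (Fin m) ℝ) (Q : Matrix (Fin n) (Fin n) ℝ),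
    IsSVD M P Q ∧ U = P.submatrix id (Fin.castLE hm) ∧ V = Q.submatrix id (Fin.castLE hn)

/-- `M'` is a rank-`r` truncated singular value decomposition `∑_{i ≤ r} σ_i(M) u_i v_iᵀ` of `M`,
that is, the best rank-`r` approximation `M_max(r)`. -/
def IsTruncatedSVD {m n : ℕ} (r : ℕ) (M M' : Matrix (Fin m) (Fin n) ℝ) : Prop :=
  ∃ (P : Matrix (Fin m) (Fin m) ℝ) (Q : Matrix (Fin n) (Fin n) ℝ), IsSVD M P Q ∧
    M' = P * pseudoDiag m n (fun k => if k < r then matSingularValue M k else 0) * Qᵀ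

/-- The diagonal of the matrix `Θ(U₁, U₂)` of principal angles between the column spans of `U₁` and `U₂`
(matrices with orthonormal columns): its entries are `arccos σ_i(U₁ᵀ U₂)`. -/
noncomputable def principalAngle {p r : ℕ} (U₁ U₂ : Matrix (Fin p) (Fin r) ℝ) (i : Fin r) : ℝ :=
  Real.arccos (matSingularValue (U₁ᵀ * U₂) i)

/-- The diagonal matrix `sin Θ(U₁, U₂)`. -/
noncomputable def sinTheta {p r : ℕ} (U₁ U₂ : Matrix (Fin p) (Fin r) ℝ) :
    Matrix (Fin r) (Fin r) ℝ :=
  Matrix.diagonal fun i => Real.sin (principalAngle U₁ U₂ i)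

/-! Let `W` and `U` hold the leading left singular vectors of `B` and `A`. The residual `U - W Wᵀ
U`, taken along the right principal vectors `R` and normalised column by column, gives a contraction
`X` with `Wᵀ X = 0` and `Xᵀ U R = diag (sin θ_k)` (`exists_principal_residual`). The contraction `Y
= V diag (σ_r / σ_k) R`, with `σ_k = σ_k(A)`, satisfies `A Y = σ_r U R`. Hence `σ_r sin θ_k = (Xᵀ B
Y)_kk - (Xᵀ Z Y)_kk`.

Sum over any `j` indices. Ky Fan's trace inequality (`IsSVDWith.sum_diag_le`) bounds the `Z` part by
the first `j` singular values of `Z` and, because `X` is orthogonal to `W`, the `B` part by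
`σ_{r+1}(B) + ⋯ + σ_{r+j}(B)`. Since `B - Z = A` has rank at most `r`, Weyl's inequality
(`singular_value_shift_le`) gives `σ_{r+i}(B) ≤ σ_i(Z)`. Both parts thus have the same bound, whence
the factor 2.

These partial sum inequalities are a weak majorization, which convexity turns into an inequality of
Schatten norms (`schattenNorm_le_of_partial_sums_le`). Only `j ≤ r` occurs, so only the first `r`
singular values of `Z` matter. The right singular vectors follow by transposition. -/

/-! ### Contractions in the operator norm -/

open scoped Matrix.Norms.L2Operator in
theorem l2_opNorm_transpose_real {m n : ℕ} (X : Matrix (Fin m) (Fin n) ℝ) : ‖Xᵀ‖ = ‖X‖ := by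
  rw [← Matrix.conjTranspose_eq_transpose_of_trivial, Matrix.l2_opNorm_conjTranspose]

open scoped Matrix.Norms.L2Operator in
theorem l2_opNorm_le_one_of_gram {m n : ℕ} {X : Matrix (Fin m) (Fin n) ℝ}
    (h : ‖Xᵀ * X‖ ≤ 1) : ‖X‖ ≤ 1 := by
  rw [← Matrix.conjTranspose_eq_transpose_of_trivial,
    Matrix.l2_opNorm_conjTranspose_mul_self] at h
  nlinarith [norm_nonneg X]

open scoped Matrix.Norms.L2Operator in
theorem l2_opNorm_diagonal_le_one {n : ℕ} {v : Fin n → ℝ} (h : ∀ i, |v i| ≤ 1) :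
    ‖Matrix.diagonal v‖ ≤ 1 := by
  rw [Matrix.l2_opNorm_diagonal]
  exact (pi_norm_le_iff_of_nonneg zero_le_one).2 h

open scoped Matrix.Norms.L2Operator in
theorem l2_opNorm_le_one_of_orthonormal_columns {m n : ℕ} {X : Matrix (Fin m) (Fin n) ℝ}
    (h : Xᵀ * X = 1) : ‖X‖ ≤ 1 := by
  apply l2_opNorm_le_one_of_gram
  rw [h, ← Matrix.diagonal_one]
  exact l2_opNorm_diagonal_le_one (by simp)

open scoped Matrix.Norms.L2Operator in
theorem sum_sq_column_le_one {m n : ℕ} {X : Matrix (Fin m) (Fin n) ℝ} (h : ‖X‖ ≤ 1)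
    (k : Fin n) : ∑ i, X i k ^ 2 ≤ 1 := by
  have h1 := Matrix.l2_opNorm_mulVec X (WithLp.toLp 2 (Pi.single k 1))
  have h2 : ‖(WithLp.toLp 2 (Pi.single k 1) : EuclideanSpace ℝ (Fin n))‖ = 1 := by simp
  rw [h2, mul_one] at h1
  have h3 := h1.trans h
  have h4 : ‖(EuclideanSpace.equiv (Fin m) ℝ).symm
      (X *ᵥ (WithLp.toLp 2 (Pi.single k 1) : EuclideanSpace ℝ (Fin n)))‖ ^ 2 =
      ∑ i, X i k ^ 2 := by
    rw [EuclideanSpace.norm_sq_eq]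
    simp
  rw [← h4]
  exact pow_le_one₀ (norm_nonneg _) h3

open scoped Matrix.Norms.L2Operator in
theorem sum_sq_row_le_one {m n : ℕ} {X : Matrix (Fin m) (Fin n) ℝ} (h : ‖X‖ ≤ 1)
    (i : Fin m) : ∑ k, X i k ^ 2 ≤ 1 :=
  sum_sq_column_le_one (X := Xᵀ) (by rwa [l2_opNorm_transpose_real]) i

/-! ### Ky Fan's trace inequality for pseudo diagonal matrices -/

/-- A weighted sum with weights in `[0, 1]` of total mass at most `j` of a decreasing sequence is
at most the sum of its first `j` terms. -/
theorem sum_weighted_tail_le {N r j : ℕ} {s : ℕ → ℝ} (hs : Antitone s) (hs0 : ∀ k, 0 ≤ s k)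
    {γ : Fin N → ℝ} (h0 : ∀ i, 0 ≤ γ i) (h1 : ∀ i, γ i ≤ 1) (hj : ∑ i, γ i ≤ j) :
    ∑ i : Fin N, (if (i : ℕ) < r then 0 else s i) * γ i ≤ ∑ i ∈ Finset.range j, s (r + i) := by
  set τ := s (r + j) with hτ
  have hτ0 : 0 ≤ τ := hs0 _
  -- `f` is the excess over the threshold `τ` on the `j` largest admissible terms. The constant part
  -- `τ` costs at most `τ * j` by the mass bound, and adding the excess gives exactly the claimed
  -- sum.
  let f : ℕ → ℝ := fun i => if i ∈ Finset.Ico r (r + j) then s i - τ else 0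
  have hf0 : ∀ i, 0 ≤ f i := by
    intro i
    simp only [f]
    split_ifs with h
    · rw [Finset.mem_Ico] at h
      exact sub_nonneg.2 (hs h.2.le)
    · exact le_rfl
  have hterm : ∀ i : Fin N, (if (i : ℕ) < r then 0 else s i) * γ i ≤ τ * γ i + f i := by
    intro i
    have := h0 i
    have := h1 i
    by_cases hi : (i : ℕ) < r
    · have := hf0 i
      rw [if_pos hi]
      nlinarith [mul_nonneg hτ0 (h0 i)]
    · rw [if_neg hi]
      by_cases hij : (i : ℕ) < r + j
      · have : f i = s i - τ := if_pos (Finset.mem_Ico.2 ⟨not_lt.1 hi, hij⟩)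
        have h3 : 0 ≤ s i - τ := this ▸ hf0 i
        rw [this]
        nlinarith
      · have h3 : s i ≤ τ := hs (not_lt.1 hij)
        have := hf0 i
        nlinarith
  have hsumf : ∑ i : Fin N, f i ≤ ∑ i ∈ Finset.Ico r (r + j), (s i - τ) := by
    rw [← Finset.sum_range]
    calc ∑ i ∈ Finset.range N, f i
        = ∑ i ∈ Finset.range N ∩ Finset.Ico r (r + j), (s i - τ) := by
          simp only [f]
          rw [Finset.sum_ite_mem]
      _ ≤ _ := by
          apply Finset.sum_le_sum_of_subset_of_nonneg Finset.inter_subset_right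
          intro i hi _
          exact sub_nonneg.2 (hs (Finset.mem_Ico.1 hi).2.le)
  have hI : ∑ i ∈ Finset.Ico r (r + j), (s i - τ) = ∑ i ∈ Finset.range j, s (r + i) - j * τ := by
    rw [Finset.sum_Ico_eq_sum_range, Finset.sum_sub_distrib]
    simp
  calc _ ≤ ∑ i : Fin N, (τ * γ i + f i) := Finset.sum_le_sum fun i _ => hterm i
    _ = τ * ∑ i, γ i + ∑ i : Fin N, f i := by rw [Finset.sum_add_distrib, Finset.mul_sum]
    _ ≤ _ := by nlinarith

-- The weights `∑ k ∈ S, X i k ^ 2` are at most 1 because rows of a contraction have norm at most 1,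
-- and their total mass is at most `S.card` because columns do.
open scoped Matrix.Norms.L2Operator in
theorem sum_weighted_gram_le {N p r : ℕ} {s : ℕ → ℝ} (hs : Antitone s) (hs0 : ∀ k, 0 ≤ s k)
    {X : Matrix (Fin N) (Fin p) ℝ} (hX : ‖X‖ ≤ 1) (S : Finset (Fin p)) :
    ∑ i : Fin N, (if (i : ℕ) < r then 0 else s i) * ∑ k ∈ S, X i k ^ 2 ≤
      ∑ i ∈ Finset.range S.card, s (r + i) := by
  refine sum_weighted_tail_le hs hs0 (fun i => Finset.sum_nonneg fun k _ => sq_nonneg _)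
    (fun i => ?_) ?_
  · exact (Finset.sum_le_univ_sum_of_nonneg fun k => sq_nonneg _).trans (sum_sq_row_le_one hX i)
  · rw [Finset.sum_comm]
    calc _ ≤ ∑ k ∈ S, (1 : ℝ) := Finset.sum_le_sum fun k _ => sum_sq_column_le_one hX k
      _ = _ := by simp

open scoped Matrix.Norms.L2Operator in
/-- Ky Fan's trace inequality for contractions, where the left family avoids the first `r`
singular directions. -/
theorem sum_diag_mul_pseudoDiag_le {m n p r : ℕ} {s : ℕ → ℝ} (hs : Antitone s)
    (hs0 : ∀ k, 0 ≤ s k) {X : Matrix (Fin m) (Fin p) ℝ} {Y : Matrix (Fin n) (Fin p) ℝ}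
    (hX : ‖X‖ ≤ 1) (hY : ‖Y‖ ≤ 1) (hXr : ∀ (i : Fin m) (k : Fin p), (i : ℕ) < r → X i k = 0) (S : Finset (Fin p)) :
    ∑ k ∈ S, (Xᵀ * pseudoDiag m n s * Y) k k ≤ ∑ i ∈ Finset.range S.card, s (r + i) := by
  -- The vanishing rows of `X` allow `s` to be cut off below `r` before `2xy ≤ x² + y²` separates
  -- `X` from `Y`. The `Y` part then carries the same truncated weights, although `Y` itself is
  -- unconstrained.
  set t : ℕ → ℝ := fun i => if i < r then 0 else s i with ht
  have ht0 : ∀ i, 0 ≤ t i := fun i => by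
    simp only [ht]
    split_ifs
    exacts [le_rfl, hs0 i]
  have hentry : ∀ k, (Xᵀ * pseudoDiag m n s * Y) k k =
      ∑ i : Fin m, ∑ l : Fin n, if (i : ℕ) = l then t i * (X i k * Y l k) else 0 := by
    intro k
    simp only [Matrix.mul_apply, Matrix.transpose_apply, pseudoDiag, Matrix.of_apply,
      Finset.sum_mul]
    rw [Finset.sum_comm]
    refine Finset.sum_congr rfl fun i _ => Finset.sum_congr rfl fun l _ => ?_
    by_cases hil : (i : ℕ) = l
    · by_cases hi : (i : ℕ) < r
      · simp [hXr i k hi]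
      · rw [if_pos hil, if_pos hil]
        simp only [ht, if_neg hi]
        ring
    · simp [hil]
  have hle : ∀ k, (Xᵀ * pseudoDiag m n s * Y) k k ≤
      (∑ i : Fin m, t i * X i k ^ 2 + ∑ l : Fin n, t l * Y l k ^ 2) / 2 := by
    intro k
    have hone : ∀ {a b : ℕ} (i : Fin a), ∑ l : Fin b, (if (i : ℕ) = l then (1 : ℝ) else 0) ≤ 1 := by
      intro a b i
      rw [Finset.sum_boole]
      have : (Finset.univ.filter fun l : Fin b => (i : ℕ) = l).card ≤ 1 :=
        Finset.card_le_one.2 fun x hx y hy => by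
          simp only [Finset.mem_filter, Finset.mem_univ, true_and] at hx hy
          exact Fin.ext (hx.symm.trans hy)
      exact_mod_cast this
    rw [hentry]
    have hsplit : ∀ (i : Fin m) (l : Fin n),
        (if (i : ℕ) = l then t i * (X i k * Y l k) else 0) ≤
        t i * X i k ^ 2 / 2 * (if (i : ℕ) = l then (1 : ℝ) else 0) +
        t l * Y l k ^ 2 / 2 * (if (l : ℕ) = i then (1 : ℝ) else 0) := by
      intro i l
      by_cases hil : (i : ℕ) = l
      · rw [if_pos hil, if_pos hil, if_pos hil.symm, ← hil]
        nlinarith [mul_nonneg (ht0 i) (sq_nonneg (X i k - Y l k))]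
      · simp [hil, Ne.symm hil]
    calc _ ≤ ∑ i : Fin m, ∑ l : Fin n, (t i * X i k ^ 2 / 2 * (if (i : ℕ) = l then (1 : ℝ) else 0) +
          t l * Y l k ^ 2 / 2 * (if (l : ℕ) = i then (1 : ℝ) else 0)) :=
          Finset.sum_le_sum fun i _ => Finset.sum_le_sum fun l _ => hsplit i l
      _ = ∑ i : Fin m, t i * X i k ^ 2 / 2 * ∑ l : Fin n, (if (i : ℕ) = l then (1 : ℝ) else 0) +
          ∑ l : Fin n, t l * Y l k ^ 2 / 2 * ∑ i : Fin m, (if (l : ℕ) = i then (1 : ℝ) else 0) := by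
          simp only [Finset.sum_add_distrib, Finset.mul_sum]
          congr 1
          exact Finset.sum_comm
      _ ≤ ∑ i : Fin m, t i * X i k ^ 2 / 2 + ∑ l : Fin n, t l * Y l k ^ 2 / 2 := by
          refine add_le_add (Finset.sum_le_sum fun i _ => ?_) (Finset.sum_le_sum fun l _ => ?_)
          · exact mul_le_of_le_one_right
              (div_nonneg (mul_nonneg (ht0 _) (sq_nonneg _)) zero_le_two) (hone i)
          · exact mul_le_of_le_one_right
              (div_nonneg (mul_nonneg (ht0 _) (sq_nonneg _)) zero_le_two) (hone l)
      _ = _ := by rw [← Finset.sum_div, ← Finset.sum_div, add_div]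
  have hX' := sum_weighted_gram_le (r := r) hs hs0 hX S
  have hY' := sum_weighted_gram_le (r := r) hs hs0 hY S
  calc _ ≤ ∑ k ∈ S, (∑ i : Fin m, t i * X i k ^ 2 + ∑ l : Fin n, t l * Y l k ^ 2) / 2 :=
        Finset.sum_le_sum fun k _ => hle k
    _ = (∑ i : Fin m, t i * ∑ k ∈ S, X i k ^ 2 + ∑ l : Fin n, t l * ∑ k ∈ S, Y l k ^ 2) / 2 := by
        rw [← Finset.sum_div, Finset.sum_add_distrib]
        simp only [Finset.mul_sum]
        rw [Finset.sum_comm, Finset.sum_comm (s := S)]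
    _ ≤ _ := by linarith

/-! ### From partial sums to power sums -/

/-- Tangent line inequality for `x ↦ x ^ p`. -/
theorem rpow_add_mul_sub_le_rpow {p x y : ℝ} (hp : 1 ≤ p) (hx : 0 ≤ x) (hy : 0 ≤ y) :
    x ^ p + p * x ^ (p - 1) * (y - x) ≤ y ^ p := by
  rcases hx.eq_or_lt with rfl | hx
  · rcases hp.eq_or_lt with rfl | hp
    · simp
    · rw [Real.zero_rpow (by linarith), Real.zero_rpow (by linarith)]
      simpa using Real.rpow_nonneg hy p
  · have h := one_add_mul_self_le_rpow_one_add (s := y / x - 1)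
      (by linarith [div_nonneg hy hx.le]) hp
    rw [add_sub_cancel, Real.div_rpow hy hx.le, le_div_iff₀ (Real.rpow_pos_of_pos hx p)] at h
    refine le_trans (le_of_eq ?_) h
    rw [Real.rpow_sub_one hx.ne']
    field_simp

/-- Abel summation: decreasing nonnegative weights preserve nonnegativity of partial sums. -/
theorem sum_mul_nonneg_of_partial_sums_nonneg {N : ℕ} {w d : ℕ → ℝ}
    (hw : Antitone w) (hw0 : ∀ k, 0 ≤ w k)
    (hd : ∀ j ≤ N, 0 ≤ ∑ k ∈ Finset.range j, d k) :
    0 ≤ ∑ k ∈ Finset.range N, w k * d k := by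
  have key : ∀ j ≤ N, w j * ∑ k ∈ Finset.range j, d k ≤ ∑ k ∈ Finset.range j, w k * d k := by
    intro j
    induction j with
    | zero => simp
    | succ j ih =>
      intro hj
      have h1 := ih (by omega)
      have h2 := hd (j + 1) hj
      have h3 := hw (Nat.le_succ j)
      have h4 := mul_le_mul_of_nonneg_right h3 h2
      rw [Finset.sum_range_succ] at h2 h4 ⊢
      rw [Finset.sum_range_succ]
      linarith
  exact (mul_nonneg (hw0 N) (hd N le_rfl)).trans (key N le_rfl)

/-- Convexity bounds `b k ^ p - a k ^ p` below by the tangent slope at `a k` times `b k - a k`. The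
slopes decrease with `k`, so Abel summation applies; no ordering of `b` is needed. -/
theorem sum_rpow_le_of_partial_sums_le {N : ℕ} {a b : ℕ → ℝ} {p : ℝ} (hp : 1 ≤ p)
    (ha : Antitone a) (ha0 : ∀ k, 0 ≤ a k) (hb0 : ∀ k, 0 ≤ b k)
    (h : ∀ j ≤ N, ∑ k ∈ Finset.range j, a k ≤ ∑ k ∈ Finset.range j, b k) :
    ∑ k ∈ Finset.range N, a k ^ p ≤ ∑ k ∈ Finset.range N, b k ^ p := by
  have h1 : 0 ≤ ∑ k ∈ Finset.range N, (p * a k ^ (p - 1)) * (b k - a k) := by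
    refine sum_mul_nonneg_of_partial_sums_nonneg (fun i j hij => ?_) (fun k => ?_) fun j hj => ?_
    · exact mul_le_mul_of_nonneg_left
        (Real.rpow_le_rpow (ha0 _) (ha hij) (by linarith)) (by linarith)
    · exact mul_nonneg (by linarith) (Real.rpow_nonneg (ha0 _) _)
    · rw [Finset.sum_sub_distrib]
      linarith [h j hj]
  have h2 := Finset.sum_le_sum fun k (_ : k ∈ Finset.range N) =>
    rpow_add_mul_sub_le_rpow hp (ha0 k) (hb0 k)
  rw [Finset.sum_add_distrib] at h2
  linarith

/-! ### Singular values through the Gram matrix, and Weyl's inequality -/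

theorem matSingularValue_nonneg {m n : ℕ} (M : Matrix (Fin m) (Fin n) ℝ) (k : ℕ) :
    0 ≤ matSingularValue M k :=
  LinearMap.singularValues_nonneg _ _

theorem matSingularValue_antitone {m n : ℕ} (M : Matrix (Fin m) (Fin n) ℝ) :
    Antitone (matSingularValue M) :=
  LinearMap.singularValues_antitone _

theorem finrank_range_toEuclideanLin {m n : ℕ} (M : Matrix (Fin m) (Fin n) ℝ) :
    Module.finrank ℝ (LinearMap.range (Matrix.toEuclideanLin M)) = M.rank := by
  rw [Matrix.toEuclideanLin, Matrix.toLpLin_eq_toLin, ← Matrix.rank_eq_finrank_range_toLin]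

theorem matSingularValue_pos_iff {m n : ℕ} (M : Matrix (Fin m) (Fin n) ℝ) (k : ℕ) :
    0 < matSingularValue M k ↔ k < M.rank := by
  rw [matSingularValue, LinearMap.singularValues_pos_iff_lt_finrank_range,
    finrank_range_toEuclideanLin]

theorem matSingularValue_eq_zero_of_rank_le {m n : ℕ} {M : Matrix (Fin m) (Fin n) ℝ} {k : ℕ}
    (h : M.rank ≤ k) : matSingularValue M k = 0 := by
  refine le_antisymm (not_lt.1 fun hk => ?_) (matSingularValue_nonneg M k)
  rw [matSingularValue_pos_iff] at hk
  omega

/-- The right singular vectors of a matrix diagonalize its Gram matrix. -/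
theorem exists_right_singular_basis {m n : ℕ} (M : Matrix (Fin m) (Fin n) ℝ) :
    ∃ Q ∈ Matrix.orthogonalGroup (Fin n) ℝ,
      Mᵀ * M = Q * Matrix.diagonal (fun k : Fin n => matSingularValue M k ^ 2) * Qᵀ := by
  obtain ⟨b, hb⟩ : ∃ b : OrthonormalBasis (Fin n) ℝ (EuclideanSpace ℝ (Fin n)), ∀ k : Fin n,
      Matrix.toEuclideanLin Mᵀ (Matrix.toEuclideanLin M (b k)) =
        (matSingularValue M k ^ 2) • b k := by
    have hn : Module.finrank ℝ (EuclideanSpace ℝ (Fin n)) = n := by simp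
    refine ⟨(Matrix.toEuclideanLin M).isSymmetric_adjoint_comp_self.eigenvectorBasis hn,
      fun k => ?_⟩
    have h := (Matrix.toEuclideanLin M).isSymmetric_adjoint_comp_self.apply_eigenvectorBasis hn k
    rw [← (Matrix.toEuclideanLin M).sq_singularValues_fin hn k] at h
    rw [← Matrix.conjTranspose_eq_transpose_of_trivial,
      Matrix.toEuclideanLin_conjTranspose_eq_adjoint]
    exact h
  let Q : Matrix (Fin n) (Fin n) ℝ := Matrix.of fun i k => b k i
  have hQ : Qᵀ * Q = 1 := by
    ext i k
    rw [Matrix.one_apply, ← (orthonormal_iff_ite.1 b.orthonormal) i k, Matrix.mul_apply,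
      PiLp.inner_apply]
    exact Finset.sum_congr rfl fun j _ => mul_comm _ _
  have hQ' : Q * Qᵀ = 1 := mul_eq_one_comm.1 hQ
  have hMQ : Mᵀ * M * Q = Q * Matrix.diagonal (fun k : Fin n => matSingularValue M k ^ 2) := by
    ext i k
    rw [Matrix.mul_diagonal, mul_comm]
    have h3 : (Mᵀ * M * Q) i k = (Mᵀ *ᵥ (M *ᵥ fun j => Q j k)) i := by
      rw [Matrix.mulVec_mulVec]
      rfl
    rw [h3]
    exact congrArg (fun v : EuclideanSpace ℝ (Fin n) => v i) (hb k)
  refine ⟨Q, (Matrix.mem_orthogonalGroup_iff _ _).2 hQ', ?_⟩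
  rw [← hMQ, Matrix.mul_assoc, hQ', Matrix.mul_one]

theorem dotProduct_mulVec_self {m n : ℕ} (M : Matrix (Fin m) (Fin n) ℝ) (x : Fin n → ℝ) :
    (M *ᵥ x) ⬝ᵥ (M *ᵥ x) = x ⬝ᵥ ((Mᵀ * M) *ᵥ x) := by
  rw [← Matrix.mulVec_mulVec, Matrix.dotProduct_mulVec x, Matrix.vecMul_transpose]

theorem dotProduct_mulVec_self_eq_sum {m n : ℕ} {M : Matrix (Fin m) (Fin n) ℝ}
    {Q : Matrix (Fin n) (Fin n) ℝ} {d : Fin n → ℝ}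
    (h : Mᵀ * M = Q * Matrix.diagonal d * Qᵀ) (x : Fin n → ℝ) :
    (M *ᵥ x) ⬝ᵥ (M *ᵥ x) = ∑ k, d k * (Qᵀ *ᵥ x) k ^ 2 := by
  rw [dotProduct_mulVec_self, h, ← Matrix.mulVec_mulVec, ← Matrix.mulVec_mulVec,
    Matrix.dotProduct_mulVec, ← Matrix.mulVec_transpose]
  simp only [dotProduct, Matrix.mulVec_diagonal]
  exact Finset.sum_congr rfl fun k _ => by ring

theorem dotProduct_self_eq_sum_of_orthogonal {n : ℕ} {Q : Matrix (Fin n) (Fin n) ℝ}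
    (hQ : Q ∈ Matrix.orthogonalGroup (Fin n) ℝ) (x : Fin n → ℝ) :
    x ⬝ᵥ x = ∑ k, (Qᵀ *ᵥ x) k ^ 2 := by
  have h := dotProduct_mulVec_self Qᵀ x
  rw [Matrix.transpose_transpose, (Matrix.mem_orthogonalGroup_iff _ _).1 hQ, Matrix.one_mulVec] at h
  rw [← h]
  simp only [dotProduct, sq]

/-- Weyl's inequality for a perturbation of rank at most `r`. -/
theorem singular_value_shift_le {m n r : ℕ} {B Z : Matrix (Fin m) (Fin n) ℝ}
    {Q Q' : Matrix (Fin n) (Fin n) ℝ} {b z : ℕ → ℝ}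
    (hQ : Q ∈ Matrix.orthogonalGroup (Fin n) ℝ) (hQ' : Q' ∈ Matrix.orthogonalGroup (Fin n) ℝ)
    (hb : Antitone b) (hb0 : ∀ k, 0 ≤ b k) (hz : Antitone z) (hz0 : ∀ k, 0 ≤ z k)
    (hB : Bᵀ * B = Q * Matrix.diagonal (fun k : Fin n => b k ^ 2) * Qᵀ)
    (hZ : Zᵀ * Z = Q' * Matrix.diagonal (fun k : Fin n => z k ^ 2) * Q'ᵀ)
    (hr : (B - Z).rank ≤ r) {i : ℕ} (hi : r + i < n) : b (r + i) ≤ z i := by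
  -- A kernel vector has no component on the columns of `Q` after index `r + i`, is killed by `B -
  -- Z`, and is orthogonal to the first `i` columns of `Q'`. The target has dimension at most `(n -
  -- r - i - 1) + r + i < n`, so a nonzero one exists.
  let L : (Fin n → ℝ) →ₗ[ℝ]
      (Fin (n - (r + i + 1)) → ℝ) × LinearMap.range (B - Z).mulVecLin × (Fin i → ℝ) :=
    LinearMap.prod
      ((LinearMap.funLeft ℝ ℝ fun k : Fin (n - (r + i + 1)) =>
        (⟨r + i + 1 + k, by omega⟩ : Fin n)) ∘ₗ Qᵀ.mulVecLin)
      (LinearMap.prod (B - Z).mulVecLin.rangeRestrict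
        ((LinearMap.funLeft ℝ ℝ fun k : Fin i => (⟨k, by omega⟩ : Fin n)) ∘ₗ Q'ᵀ.mulVecLin))
  have hker : LinearMap.ker L ≠ ⊥ := by
    apply LinearMap.ker_ne_bot_of_finrank_lt
    have : Module.finrank ℝ (LinearMap.range (B - Z).mulVecLin) ≤ r := hr
    simp only [Module.finrank_prod, Module.finrank_fin_fun]
    omega
  obtain ⟨x, hx, hx0⟩ := Submodule.exists_mem_ne_zero_of_ne_bot hker
  rw [LinearMap.mem_ker] at hx
  have e1 : ∀ k : Fin n, r + i < k → (Qᵀ *ᵥ x) k = 0 := by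
    intro k hk
    have := congrFun (congrArg Prod.fst hx) ⟨k - (r + i + 1), by omega⟩
    simp only [L, LinearMap.prod_apply, Function.prod_apply, LinearMap.comp_apply,
      LinearMap.funLeft_apply, Matrix.mulVecLin_apply] at this
    convert! this using 2
    ext
    simp
    omega
  have e2 : B *ᵥ x = Z *ᵥ x := by
    have := congrArg (fun p => (p.2.1 : Fin m → ℝ)) hx
    have h2 : (B - Z) *ᵥ x = 0 := this
    rwa [Matrix.sub_mulVec, sub_eq_zero] at h2
  have e3 : ∀ k : Fin n, (k : ℕ) < i → (Q'ᵀ *ᵥ x) k = 0 := by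
    intro k hk
    exact congrFun (congrArg (fun p => p.2.2) hx) ⟨k, hk⟩
  have hpos : 0 < x ⬝ᵥ x := by
    refine lt_of_le_of_ne (Finset.sum_nonneg fun k _ => mul_self_nonneg _) fun h => hx0 ?_
    exact dotProduct_self_eq_zero.1 h.symm
  have l1 : b (r + i) ^ 2 * (x ⬝ᵥ x) ≤ (B *ᵥ x) ⬝ᵥ (B *ᵥ x) := by
    rw [dotProduct_mulVec_self_eq_sum hB, dotProduct_self_eq_sum_of_orthogonal hQ, Finset.mul_sum]
    refine Finset.sum_le_sum fun k _ => ?_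
    rcases lt_or_ge (r + i) (k : ℕ) with hk | hk
    · simp [e1 k hk]
    · exact mul_le_mul_of_nonneg_right (pow_le_pow_left₀ (hb0 _) (hb hk) 2) (sq_nonneg _)
  have l2 : (Z *ᵥ x) ⬝ᵥ (Z *ᵥ x) ≤ z i ^ 2 * (x ⬝ᵥ x) := by
    rw [dotProduct_mulVec_self_eq_sum hZ, dotProduct_self_eq_sum_of_orthogonal hQ', Finset.mul_sum]
    refine Finset.sum_le_sum fun k _ => ?_
    rcases lt_or_ge (k : ℕ) i with hk | hk
    · simp [e3 k hk]
    · exact mul_le_mul_of_nonneg_right (pow_le_pow_left₀ (hz0 _) (hz hk) 2) (sq_nonneg _)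
  rw [e2] at l1
  exact le_of_sq_le_sq (le_of_mul_le_mul_right (l1.trans l2) hpos) (hz0 i)

/-- The singular values are determined by any sorted diagonalization of the Gram matrix. -/
theorem matSingularValue_eq_of_gram {m n : ℕ} {M : Matrix (Fin m) (Fin n) ℝ}
    {Q : Matrix (Fin n) (Fin n) ℝ} {s : ℕ → ℝ} (hQ : Q ∈ Matrix.orthogonalGroup (Fin n) ℝ)
    (hs : Antitone s) (hs0 : ∀ k, 0 ≤ s k)
    (hM : Mᵀ * M = Q * Matrix.diagonal (fun k : Fin n => s k ^ 2) * Qᵀ) {k : ℕ} (hk : k < n) :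
    matSingularValue M k = s k := by
  obtain ⟨Q', hQ', hM'⟩ := exists_right_singular_basis M
  -- Weyl's inequality with zero perturbation, in both directions, compares the two
  -- diagonalizations.
  have h0 : (M - M).rank ≤ 0 := by simp
  apply le_antisymm
  · simpa using singular_value_shift_le hQ' hQ (matSingularValue_antitone M)
      (matSingularValue_nonneg M) hs hs0 hM' hM h0 (i := k) (by omega)
  · simpa using singular_value_shift_le hQ hQ' hs hs0 (matSingularValue_antitone M)
      (matSingularValue_nonneg M) hM hM' h0 (i := k) (by omega)

/-! ### Singular value decompositions as data -/

/-- A full singular value decomposition of `M` with prescribed decreasing singular values `s`. -/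
structure IsSVDWith {m n : ℕ} (M : Matrix (Fin m) (Fin n) ℝ) (P : Matrix (Fin m) (Fin m) ℝ)
    (Q : Matrix (Fin n) (Fin n) ℝ) (s : ℕ → ℝ) : Prop where
  left_orthogonal : P ∈ Matrix.orthogonalGroup (Fin m) ℝ
  right_orthogonal : Q ∈ Matrix.orthogonalGroup (Fin n) ℝ
  eq_mul : M = P * pseudoDiag m n s * Qᵀ
  antitone : Antitone s
  nonneg : ∀ k, 0 ≤ s k
  eq_zero : ∀ k, min m n ≤ k → s k = 0

theorem pseudoDiag_transpose (m n : ℕ) (s : ℕ → ℝ) : (pseudoDiag m n s)ᵀ = pseudoDiag n m s := by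
  ext i j
  simp only [pseudoDiag, Matrix.transpose_apply, Matrix.of_apply]
  by_cases h : (i : ℕ) = j
  · simp [h]
  · simp [h, Ne.symm h]

theorem pseudoDiag_gram {m n : ℕ} {s : ℕ → ℝ} (hs : ∀ k, min m n ≤ k → s k = 0) :
    (pseudoDiag m n s)ᵀ * pseudoDiag m n s = Matrix.diagonal fun k : Fin n => s k ^ 2 := by
  ext i j
  simp only [Matrix.mul_apply, Matrix.transpose_apply, pseudoDiag, Matrix.of_apply,
    Matrix.diagonal_apply]
  by_cases hi : (i : ℕ) < m
  · rw [Finset.sum_eq_single (⟨i, hi⟩ : Fin m)]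
    · by_cases hij : i = j
      · simp [hij, sq]
      · simp [hij, Fin.val_inj]
    · intro k _ hk
      rw [if_neg, zero_mul]
      exact fun h => hk (Fin.ext h)
    · simp
  · rw [Finset.sum_eq_zero]
    · rw [hs i (by omega)]
      simp
    · intro k _
      rw [if_neg (by omega), zero_mul]

namespace IsSVDWith

variable {m n : ℕ} {M : Matrix (Fin m) (Fin n) ℝ} {P : Matrix (Fin m) (Fin m) ℝ}
  {Q : Matrix (Fin n) (Fin n) ℝ} {s : ℕ → ℝ}

/-- Keeping `s` as data lets the right-hand bound reuse the same sequence, without comparing the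
singular values of `M` and `Mᵀ`. -/
theorem transpose (h : IsSVDWith M P Q s) : IsSVDWith Mᵀ Q P s where
  left_orthogonal := h.right_orthogonal
  right_orthogonal := h.left_orthogonal
  eq_mul := by
    rw [h.eq_mul, Matrix.transpose_mul, Matrix.transpose_mul, Matrix.transpose_transpose,
      pseudoDiag_transpose, Matrix.mul_assoc]
  antitone := h.antitone
  nonneg := h.nonneg
  eq_zero := fun k hk => h.eq_zero k (by rwa [min_comm])

theorem gram (h : IsSVDWith M P Q s) :
    Mᵀ * M = Q * Matrix.diagonal (fun k : Fin n => s k ^ 2) * Qᵀ := by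
  have hP : Pᵀ * P = 1 := (Matrix.mem_orthogonalGroup_iff' _ _).1 h.left_orthogonal
  rw [← pseudoDiag_gram h.eq_zero]
  conv_lhs => rw [h.eq_mul]
  simp only [Matrix.transpose_mul, Matrix.transpose_transpose, Matrix.mul_assoc]
  rw [← Matrix.mul_assoc Pᵀ, hP, Matrix.one_mul]

theorem matSingularValue_eq (h : IsSVDWith M P Q s) {k : ℕ} (hk : k < n) :
    matSingularValue M k = s k :=
  matSingularValue_eq_of_gram h.right_orthogonal h.antitone h.nonneg h.gram hk

end IsSVDWith

theorem IsSVD.isSVDWith {m n : ℕ} {M : Matrix (Fin m) (Fin n) ℝ} {P : Matrix (Fin m) (Fin m) ℝ}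
    {Q : Matrix (Fin n) (Fin n) ℝ} (h : IsSVD M P Q) :
    IsSVDWith M P Q (matSingularValue M) where
  left_orthogonal := h.left_orthogonal
  right_orthogonal := h.right_orthogonal
  eq_mul := h.eq_mul
  antitone := matSingularValue_antitone M
  nonneg := matSingularValue_nonneg M
  eq_zero := fun _ hk => matSingularValue_eq_zero_of_rank_le
    ((le_min (by simpa using M.rank_le_height) (by simpa using M.rank_le_width)).trans hk)

theorem transpose_mul_submatrix_castLE {m r : ℕ} (hm : r ≤ m) {P : Matrix (Fin m) (Fin m) ℝ}
    (hP : P ∈ Matrix.orthogonalGroup (Fin m) ℝ) :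
    (P.submatrix id (Fin.castLE hm))ᵀ * P.submatrix id (Fin.castLE hm) = 1 := by
  have h : Pᵀ * P = 1 := (Matrix.mem_orthogonalGroup_iff' _ _).1 hP
  ext i j
  have := congrFun (congrFun h (Fin.castLE hm i)) (Fin.castLE hm j)
  rw [Matrix.one_apply] at this ⊢
  simp only [Fin.castLE_inj] at this
  rw [← this]
  rfl

theorem pseudoDiag_submatrix_castLE {m n r : ℕ} (hm : r ≤ m) (hn : r ≤ n) (s : ℕ → ℝ) :
    (pseudoDiag m n s).submatrix id (Fin.castLE hn) =
      (1 : Matrix (Fin m) (Fin m) ℝ).submatrix id (Fin.castLE hm) *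
        Matrix.diagonal fun k : Fin r => s k := by
  ext i j
  rw [Matrix.mul_diagonal]
  simp only [Matrix.submatrix_apply, id, pseudoDiag, Matrix.of_apply, Matrix.one_apply,
    Fin.ext_iff, Fin.val_castLE]
  by_cases h : (i : ℕ) = j
  · simp [h]
  · simp [h]

theorem IsSVDWith.mul_leading_right {m n r : ℕ} {M : Matrix (Fin m) (Fin n) ℝ}
    {P : Matrix (Fin m) (Fin m) ℝ} {Q : Matrix (Fin n) (Fin n) ℝ} {s : ℕ → ℝ}
    (h : IsSVDWith M P Q s) (hm : r ≤ m) (hn : r ≤ n) :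
    M * Q.submatrix id (Fin.castLE hn) =
      P.submatrix id (Fin.castLE hm) * Matrix.diagonal fun k : Fin r => s k := by
  have hQ : Qᵀ * Q = 1 := (Matrix.mem_orthogonalGroup_iff' _ _).1 h.right_orthogonal
  have h1 : M * Q = P * pseudoDiag m n s := by
    rw [h.eq_mul, Matrix.mul_assoc, hQ, Matrix.mul_one]
  have h2 : M * Q.submatrix id (Fin.castLE hn) = (M * Q).submatrix id (Fin.castLE hn) := rfl
  have h3 : (P * pseudoDiag m n s).submatrix id (Fin.castLE hn) =
      P * (pseudoDiag m n s).submatrix id (Fin.castLE hn) := rfl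
  have h4 : P * (1 : Matrix (Fin m) (Fin m) ℝ).submatrix id (Fin.castLE hm) =
      (P * 1).submatrix id (Fin.castLE hm) := rfl
  rw [h2, h1, h3, pseudoDiag_submatrix_castLE hm hn, ← Matrix.mul_assoc, h4, Matrix.mul_one]

/-! ### Principal angles -/

/-- Given orthonormal `W`, `U`, there are right principal vectors `R` and a contraction `X`
orthogonal to `W` pairing with the principal vectors of `U` to the sines of the principal angles. -/
theorem exists_principal_residual {p r : ℕ} {W U : Matrix (Fin p) (Fin r) ℝ}
    (hW : Wᵀ * W = 1) (hU : Uᵀ * U = 1) :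
    ∃ (R : Matrix (Fin r) (Fin r) ℝ) (X : Matrix (Fin p) (Fin r) ℝ),
      Rᵀ * R = 1 ∧ Xᵀ * X = Matrix.diagonal (fun k : Fin r =>
        if Real.sin (principalAngle W U k) = 0 then 0 else 1) ∧ Wᵀ * X = 0 ∧
      Xᵀ * U * R = Matrix.diagonal fun k => Real.sin (principalAngle W U k) := by
  obtain ⟨R, hR, hC⟩ := exists_right_singular_basis (Wᵀ * U)
  have hR1 : Rᵀ * R = 1 := (Matrix.mem_orthogonalGroup_iff' _ _).1 hR
  set c : Fin r → ℝ := fun k => matSingularValue (Wᵀ * U) k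
  set s : Fin r → ℝ := fun k => Real.sin (principalAngle W U k)
  have hs' : ∀ k, s k = √(1 - c k ^ 2) := fun k => Real.sin_arccos _
  set G : Matrix (Fin p) (Fin r) ℝ := U - W * (Wᵀ * U) with hG
  have hWG : Wᵀ * G = 0 := by
    rw [hG, Matrix.mul_sub, ← Matrix.mul_assoc, hW, Matrix.one_mul, sub_self]
  have hGW : Gᵀ * W = 0 := by
    rw [← Matrix.transpose_transpose W, ← Matrix.transpose_mul, hWG, Matrix.transpose_zero]
  have hGU : Gᵀ * U = 1 - (Wᵀ * U)ᵀ * (Wᵀ * U) := by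
    rw [hG, Matrix.transpose_sub, Matrix.sub_mul, hU, Matrix.transpose_mul W, Matrix.mul_assoc]
  have hGG : Gᵀ * G = Gᵀ * U := by
    conv_lhs => rw [hG]
    rw [← hG, Matrix.mul_sub, ← Matrix.mul_assoc, hGW, Matrix.zero_mul, sub_zero]
  have hRGUR : Rᵀ * (Gᵀ * U) * R = Matrix.diagonal fun k => 1 - c k ^ 2 := by
    rw [hGU, hC, Matrix.mul_sub, Matrix.sub_mul, Matrix.mul_one, hR1]
    have : Rᵀ * (R * Matrix.diagonal (fun k : Fin r => c k ^ 2) * Rᵀ) * R =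
        (Rᵀ * R) * Matrix.diagonal (fun k : Fin r => c k ^ 2) * (Rᵀ * R) := by
      simp only [Matrix.mul_assoc]
    rw [this, hR1, Matrix.one_mul, Matrix.mul_one, ← Matrix.diagonal_one, Matrix.diagonal_sub]
  -- The entry is a squared column norm of `G * R`. Without this sign, `√(1 - c k ^ 2)` would be
  -- truncated to 0 and its square could differ from `1 - c k ^ 2`.
  have hpos : ∀ k, 0 ≤ 1 - c k ^ 2 := by
    intro k
    have h := congrFun (congrFun hRGUR k) k
    rw [← hGG, Matrix.diagonal_apply_eq] at h
    rw [← h]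
    have h2 : Rᵀ * (Gᵀ * G) * R = (G * R)ᵀ * (G * R) := by
      simp only [Matrix.transpose_mul, Matrix.mul_assoc]
    rw [h2, Matrix.mul_apply]
    exact Finset.sum_nonneg fun i _ => mul_self_nonneg _
  have hsq : (fun k => 1 - c k ^ 2) = fun k => s k * s k := by
    funext k
    rw [hs', Real.mul_self_sqrt (hpos k)]
  rw [hsq] at hRGUR
  -- Since `0⁻¹ = 0`, columns with zero sine become zero. Thus `X` is only a partial isometry, but
  -- its pairing with `U * R` is `s k` in every case.
  refine ⟨R, G * R * Matrix.diagonal fun k => (s k)⁻¹, hR1, ?_, ?_, ?_⟩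
  · have : (G * R * Matrix.diagonal fun k => (s k)⁻¹)ᵀ * (G * R * Matrix.diagonal fun k => (s k)⁻¹) =
        (Matrix.diagonal fun k => (s k)⁻¹) * (Rᵀ * (Gᵀ * G) * R) *
          Matrix.diagonal fun k => (s k)⁻¹ := by
      simp only [Matrix.transpose_mul, Matrix.diagonal_transpose, Matrix.mul_assoc]
    rw [this, hGG, hRGUR, Matrix.diagonal_mul_diagonal, Matrix.diagonal_mul_diagonal]
    congr 1
    funext k
    by_cases h : s k = 0
    · rw [if_pos h]
      simp [h]
    · rw [if_neg h]
      field_simp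
  · rw [← Matrix.mul_assoc, ← Matrix.mul_assoc, hWG, Matrix.zero_mul, Matrix.zero_mul]
  · have : (G * R * Matrix.diagonal fun k => (s k)⁻¹)ᵀ * U * R =
        (Matrix.diagonal fun k => (s k)⁻¹) * (Rᵀ * (Gᵀ * U) * R) := by
      simp only [Matrix.transpose_mul, Matrix.diagonal_transpose, Matrix.mul_assoc]
    rw [this, hRGUR, Matrix.diagonal_mul_diagonal]
    congr 1
    funext k
    by_cases h : s k = 0
    · simp [h]
    · field_simp

/-! ### Partial sums of the sines -/

open scoped Matrix.Norms.L2Operator in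
theorem l2_opNorm_mul_le_one {l m n : ℕ} {X : Matrix (Fin l) (Fin m) ℝ}
    {Y : Matrix (Fin m) (Fin n) ℝ} (hX : ‖X‖ ≤ 1) (hY : ‖Y‖ ≤ 1) : ‖X * Y‖ ≤ 1 :=
  (Matrix.l2_opNorm_mul X Y).trans (mul_le_one₀ hX (norm_nonneg _) hY)

open scoped Matrix.Norms.L2Operator in
/-- Ky Fan's trace inequality for a matrix with a given singular value decomposition. -/
theorem IsSVDWith.sum_diag_le {m n p r : ℕ} {M : Matrix (Fin m) (Fin n) ℝ}
    {P : Matrix (Fin m) (Fin m) ℝ} {Q : Matrix (Fin n) (Fin n) ℝ} {s : ℕ → ℝ}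
    (h : IsSVDWith M P Q s) (hm : r ≤ m) {X : Matrix (Fin m) (Fin p) ℝ}
    {Y : Matrix (Fin n) (Fin p) ℝ} (hX : ‖X‖ ≤ 1) (hY : ‖Y‖ ≤ 1)
    (hXr : (P.submatrix id (Fin.castLE hm))ᵀ * X = 0) (S : Finset (Fin p)) :
    ∑ k ∈ S, (Xᵀ * M * Y) k k ≤ ∑ i ∈ Finset.range S.card, s (r + i) := by
  have hP : ‖Pᵀ‖ ≤ 1 := by
    rw [l2_opNorm_transpose_real]
    exact l2_opNorm_le_one_of_orthonormal_columns
      ((Matrix.mem_orthogonalGroup_iff' _ _).1 h.left_orthogonal)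
  have hQ : ‖Qᵀ‖ ≤ 1 := by
    rw [l2_opNorm_transpose_real]
    exact l2_opNorm_le_one_of_orthonormal_columns
      ((Matrix.mem_orthogonalGroup_iff' _ _).1 h.right_orthogonal)
  have hzero : ∀ (i : Fin m) (k : Fin p), (i : ℕ) < r → (Pᵀ * X) i k = 0 :=
    fun i k hi => congrFun (congrFun hXr ⟨i, hi⟩) k
  have key := sum_diag_mul_pseudoDiag_le h.antitone h.nonneg
    (l2_opNorm_mul_le_one hP hX) (l2_opNorm_mul_le_one hQ hY) hzero S
  have heq : Xᵀ * M * Y = (Pᵀ * X)ᵀ * pseudoDiag m n s * (Qᵀ * Y) := by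
    rw [h.eq_mul]
    simp only [Matrix.transpose_mul, Matrix.transpose_transpose, Matrix.mul_assoc]
  rwa [heq]

open scoped Matrix.Norms.L2Operator in
/-- Partial sums of the sines of the principal angles between the leading left singular spaces of
a rank `r` matrix `A` and of its perturbation `A + Z`. -/
theorem mul_sum_sin_principalAngle_le {m n r : ℕ} {A B Z : Matrix (Fin m) (Fin n) ℝ}
    {PA PB PZ : Matrix (Fin m) (Fin m) ℝ} {QA QB QZ : Matrix (Fin n) (Fin n) ℝ} {a b z : ℕ → ℝ}
    (hA : IsSVDWith A PA QA a) (hB : IsSVDWith B PB QB b) (hZ : IsSVDWith Z PZ QZ z)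
    (hAB : B = A + Z) (hrank : A.rank ≤ r) (hm : r ≤ m) (hn : r ≤ n) (ha : 0 < a (r - 1))
    (S : Finset (Fin r)) :
    a (r - 1) * ∑ k ∈ S, Real.sin (principalAngle (PB.submatrix id (Fin.castLE hm))
        (PA.submatrix id (Fin.castLE hm)) k) ≤
      2 * ∑ i ∈ Finset.range S.card, z i := by
  set W := PB.submatrix id (Fin.castLE hm)
  set U := PA.submatrix id (Fin.castLE hm)
  set V := QA.submatrix id (Fin.castLE hn)
  have hU : Uᵀ * U = 1 := transpose_mul_submatrix_castLE hm hA.left_orthogonal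
  have hV : Vᵀ * V = 1 := transpose_mul_submatrix_castLE hn hA.right_orthogonal
  have hW : Wᵀ * W = 1 := transpose_mul_submatrix_castLE hm hB.left_orthogonal
  obtain ⟨R, X, hR, hXX, hWX, hXUR⟩ := exists_principal_residual hW hU
  have hX : ‖X‖ ≤ 1 := by
    apply l2_opNorm_le_one_of_gram
    rw [hXX]
    refine l2_opNorm_diagonal_le_one fun k => ?_
    split_ifs <;> simp
  have hak : ∀ k : Fin r, a (r - 1) ≤ a k := fun k => hA.antitone (by omega)
  -- The scaling equalises the leading singular values of `A` to the smallest one, `a (r - 1)`; the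
  -- ratios are at most 1, so `Y` stays a contraction.
  set Y := V * Matrix.diagonal (fun k : Fin r => a (r - 1) / a k) * R with hYdef
  have hY : ‖Y‖ ≤ 1 := by
    refine l2_opNorm_mul_le_one (l2_opNorm_mul_le_one
      (l2_opNorm_le_one_of_orthonormal_columns hV) (l2_opNorm_diagonal_le_one fun k => ?_))
      (l2_opNorm_le_one_of_orthonormal_columns hR)
    have := ha.trans_le (hak k)
    rw [abs_of_nonneg (by positivity), div_le_one this]
    exact hak k
  have hAY : A * Y = a (r - 1) • (U * R) := by
    have hdiag : Matrix.diagonal (fun k : Fin r => a k) *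
        Matrix.diagonal (fun k : Fin r => a (r - 1) / a k) = a (r - 1) • 1 := by
      rw [Matrix.diagonal_mul_diagonal, Matrix.smul_one_eq_diagonal]
      congr 1
      funext k
      exact mul_div_cancel₀ _ (ha.trans_le (hak k)).ne'
    rw [hYdef, ← Matrix.mul_assoc, ← Matrix.mul_assoc, hA.mul_leading_right hm hn,
      Matrix.mul_assoc (PA.submatrix id (Fin.castLE hm)), hdiag, Matrix.mul_smul, Matrix.mul_one,
      Matrix.smul_mul]
  have hXAY : Xᵀ * A * Y =
      a (r - 1) • Matrix.diagonal fun k => Real.sin (principalAngle W U k) := by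
    rw [Matrix.mul_assoc, hAY, Matrix.mul_smul, ← Matrix.mul_assoc, hXUR]
  have hsplit : Xᵀ * A * Y = Xᵀ * B * Y + (-X)ᵀ * Z * Y := by
    rw [hAB, Matrix.transpose_neg, Matrix.mul_add, Matrix.add_mul, Matrix.neg_mul, Matrix.neg_mul,
      add_neg_cancel_right]
  have hleft : a (r - 1) * ∑ k ∈ S, Real.sin (principalAngle W U k) =
      ∑ k ∈ S, (Xᵀ * B * Y) k k + ∑ k ∈ S, ((-X)ᵀ * Z * Y) k k := by
    rw [← Finset.sum_add_distrib, Finset.mul_sum]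
    refine Finset.sum_congr rfl fun k _ => ?_
    rw [← Matrix.add_apply, ← hsplit, hXAY, Matrix.smul_apply, Matrix.diagonal_apply_eq,
      smul_eq_mul]
  have h1 := hB.sum_diag_le hm hX hY hWX S
  -- For `Z` no directions are excluded, so the orthogonality condition is empty. The sign is
  -- absorbed into `X`, since the trace bound is one-sided.
  have h2 := hZ.sum_diag_le (Nat.zero_le m) (X := -X) (by rwa [norm_neg]) hY
    (by ext i; exact i.elim0) S
  have h3 : ∑ i ∈ Finset.range S.card, b (r + i) ≤ ∑ i ∈ Finset.range S.card, z i := by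
    refine Finset.sum_le_sum fun i _ => ?_
    by_cases hi : r + i < n
    · refine singular_value_shift_le hB.right_orthogonal hZ.right_orthogonal hB.antitone hB.nonneg
        hZ.antitone hZ.nonneg hB.gram hZ.gram ?_ hi
      rwa [hAB, add_sub_cancel_right]
    · rw [hB.eq_zero _ (by omega)]
      exact hZ.nonneg i
  simp only [Nat.zero_add] at h2
  rw [hleft]
  linarith

/-! ### Schatten norms of the sine matrix -/

/-- Decreasing cosines make the sines increase along the diagonal, so sorting them reverses the
index; conjugation by the reversal permutation `J` realises this. -/
theorem matSingularValue_sinTheta {p r : ℕ} (W U : Matrix (Fin p) (Fin r) ℝ)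
    {k : ℕ} (hk : k < r) :
    matSingularValue (sinTheta W U) k =
      Real.sin (principalAngle W U (Fin.rev ⟨k, hk⟩)) := by
  let s : Fin r → ℝ := fun k => Real.sin (principalAngle W U k)
  have hs0 : ∀ k, 0 ≤ s k := fun k =>
    Real.sin_nonneg_of_nonneg_of_le_pi (Real.arccos_nonneg _) (Real.arccos_le_pi _)
  have hs : Monotone s := by
    intro i j hij
    simp only [s, principalAngle, Real.sin_arccos]
    apply Real.sqrt_le_sqrt
    have := matSingularValue_antitone (Wᵀ * U) (show (i : ℕ) ≤ j from hij)
    have := matSingularValue_nonneg (Wᵀ * U) j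
    gcongr
  let d : ℕ → ℝ := fun k => if h : k < r then s (Fin.rev ⟨k, h⟩) else 0
  have hd0 : ∀ k, 0 ≤ d k := by
    intro k
    simp only [d]
    split_ifs
    exacts [hs0 _, le_rfl]
  have hd : Antitone d := by
    intro i j hij
    by_cases hj : j < r
    · simp only [d, dif_pos hj, dif_pos (hij.trans_lt hj)]
      exact hs (Fin.rev_le_rev.2 hij)
    · have : d j = 0 := dif_neg hj
      rw [this]
      exact hd0 i
  let J : Matrix (Fin r) (Fin r) ℝ := Matrix.of fun i j => if i = Fin.rev j then 1 else 0
  have hJ : ∀ e : Fin r → ℝ, J * Matrix.diagonal e * Jᵀ = Matrix.diagonal fun k => e (Fin.rev k) := by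
    intro e
    ext i j
    rw [Matrix.mul_apply, Finset.sum_eq_single (Fin.rev i)]
    · by_cases hij : i = j
      · simp [J, hij]
      · simp [J, hij, Ne.symm hij]
    · intro k _ hk
      have : i ≠ Fin.rev k := fun h => hk (by rw [h, Fin.rev_rev])
      simp [J, this]
    · simp
  have hJo : J ∈ Matrix.orthogonalGroup (Fin r) ℝ := by
    rw [Matrix.mem_orthogonalGroup_iff]
    have := hJ 1
    rw [Matrix.diagonal_one', Matrix.mul_one] at this
    rw [this]
    exact Matrix.diagonal_one
  have hgram : (sinTheta W U)ᵀ * sinTheta W U =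
      J * Matrix.diagonal (fun k : Fin r => d k ^ 2) * Jᵀ := by
    rw [hJ, sinTheta, Matrix.diagonal_transpose, Matrix.diagonal_mul_diagonal]
    congr 1
    funext k
    have : d (Fin.rev k) = s k := by
      simp only [d]
      rw [dif_pos (Fin.rev k).isLt]
      exact congrArg s (Fin.rev_rev k)
    rw [this, sq]
  rw [matSingularValue_eq_of_gram hJo hd hd0 hgram hk]
  exact dif_pos hk

theorem sum_range_matSingularValue_sinTheta {p r j : ℕ} (W U : Matrix (Fin p) (Fin r) ℝ)
    (hj : j ≤ r) : ∃ S : Finset (Fin r), S.card = j ∧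
      ∑ k ∈ Finset.range j, matSingularValue (sinTheta W U) k =
        ∑ k ∈ S, Real.sin (principalAngle W U k) := by
  refine ⟨Finset.univ.map ((Fin.castLEEmb hj).trans Fin.revPerm.toEmbedding), by simp, ?_⟩
  rw [Finset.sum_map, Finset.sum_range]
  exact Finset.sum_congr rfl fun k _ =>
    matSingularValue_sinTheta W U (k.isLt.trans_le hj)

theorem schattenNorm_le_of_partial_sums_le {r m n : ℕ} (hr : 1 ≤ r) (hm : r ≤ m) (hn : r ≤ n)
    {D : Matrix (Fin r) (Fin r) ℝ} {M : Matrix (Fin m) (Fin n) ℝ} {α : ℝ} (hα : 0 ≤ α)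
    (h : ∀ j ≤ r, α * ∑ k ∈ Finset.range j, matSingularValue D k ≤
      ∑ k ∈ Finset.range j, matSingularValue M k) {q : ℝ≥0∞} (hq : 1 ≤ q) :
    α * schattenNorm q D ≤ schattenNorm q M := by
  unfold schattenNorm
  split_ifs with hq'
  -- For `q = ∞` the partial sum with `j = 1` already compares the largest singular values.
  · simpa using h 1 hr
  · have hp : 1 ≤ q.toReal := by
      rw [← ENNReal.toReal_one]
      exact ENNReal.toReal_mono hq' hq
    have hp0 : 0 < q.toReal := by linarith
    have h1 : ∑ k ∈ Finset.range r, (α * matSingularValue D k) ^ q.toReal ≤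
        ∑ k ∈ Finset.range (min m n), matSingularValue M k ^ q.toReal := by
      refine (sum_rpow_le_of_partial_sums_le hp (b := matSingularValue M)
        (fun i j hij => mul_le_mul_of_nonneg_left (matSingularValue_antitone D hij) hα)
        (fun k => mul_nonneg hα (matSingularValue_nonneg D k)) (matSingularValue_nonneg M)
        (fun j hj => ?_)).trans ?_
      · rw [← Finset.mul_sum]
        exact h j hj
      · exact Finset.sum_le_sum_of_subset_of_nonneg
          (Finset.range_subset_range.2 (le_min hm hn))
          fun k _ _ => Real.rpow_nonneg (matSingularValue_nonneg M k) _
    have h2 : ∑ k ∈ Finset.range r, (α * matSingularValue D k) ^ q.toReal =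
        α ^ q.toReal * ∑ k ∈ Finset.range r, matSingularValue D k ^ q.toReal := by
      rw [Finset.mul_sum]
      exact Finset.sum_congr rfl fun k _ => Real.mul_rpow hα (matSingularValue_nonneg D k)
    have hD0 : 0 ≤ ∑ k ∈ Finset.range r, matSingularValue D k ^ q.toReal :=
      Finset.sum_nonneg fun k _ => Real.rpow_nonneg (matSingularValue_nonneg D k) _
    have h3 : α = (α ^ q.toReal) ^ (1 / q.toReal) := by
      rw [← Real.rpow_mul hα, mul_one_div_cancel hp0.ne', Real.rpow_one]
    rw [min_self]
    conv_lhs => rw [h3]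
    rw [← Real.mul_rpow (Real.rpow_nonneg hα _) hD0, ← h2]
    exact Real.rpow_le_rpow (h2 ▸ mul_nonneg (Real.rpow_nonneg hα _) hD0) h1 (by positivity)

/-- The truncated sequence is still decreasing and nonnegative, so the defining factorization is
itself a singular value decomposition of `M'`. -/
theorem IsTruncatedSVD.matSingularValue_eq {m n r : ℕ} {M M' : Matrix (Fin m) (Fin n) ℝ}
    (h : IsTruncatedSVD r M M') {k : ℕ} (hk : k < r) (hn : r ≤ n) :
    matSingularValue M' k = matSingularValue M k := by
  obtain ⟨P, Q, hSVD, hM'⟩ := h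
  have h' : IsSVDWith M' P Q (fun k => if k < r then matSingularValue M k else 0) := by
    refine ⟨hSVD.left_orthogonal, hSVD.right_orthogonal, hM', fun i j hij => ?_, fun k => ?_,
      fun k hk => ?_⟩
    · split_ifs with h1 h2
      · exact matSingularValue_antitone M hij
      · omega
      · exact matSingularValue_nonneg M i
      · exact le_rfl
    · split_ifs
      exacts [matSingularValue_nonneg M k, le_rfl]
    · split_ifs
      exacts [hSVD.isSVDWith.eq_zero k hk, rfl]
  rw [h'.matSingularValue_eq (hk.trans_le hn), if_pos hk]

/-- The Schatten norm bound for one side, with all decompositions given as data. -/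
theorem schattenNorm_sinTheta_le {m n r m' n' : ℕ} {A B Z : Matrix (Fin m) (Fin n) ℝ}
    {PA PB PZ : Matrix (Fin m) (Fin m) ℝ} {QA QB QZ : Matrix (Fin n) (Fin n) ℝ} {a b z : ℕ → ℝ}
    {M : Matrix (Fin m') (Fin n') ℝ}
    (hA : IsSVDWith A PA QA a) (hB : IsSVDWith B PB QB b) (hZ : IsSVDWith Z PZ QZ z)
    (hAB : B = A + Z) (hrank : A.rank ≤ r) (hr : 1 ≤ r) (hm : r ≤ m) (hn : r ≤ n)
    (hm' : r ≤ m') (hn' : r ≤ n') (ha : 0 < a (r - 1))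
    (hM : ∀ k < r, matSingularValue M k = z k) {q : ℝ≥0∞} (hq : 1 ≤ q) :
    schattenNorm q (sinTheta (PB.submatrix id (Fin.castLE hm)) (PA.submatrix id (Fin.castLE hm))) ≤
      2 * schattenNorm q M / a (r - 1) := by
  rw [le_div_iff₀ ha]
  have := schattenNorm_le_of_partial_sums_le hr hm' hn' (M := M)
    (D := sinTheta (PB.submatrix id (Fin.castLE hm)) (PA.submatrix id (Fin.castLE hm)))
    -- The 2 from the sine estimate goes into `α`, leaving a plain majorization by the singular
    -- values of `M`.
    (α := a (r - 1) / 2) (by positivity) (fun j hj => ?_) hq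
  · linarith
  · obtain ⟨S, hS, hsum⟩ := sum_range_matSingularValue_sinTheta
      (PB.submatrix id (Fin.castLE hm)) (PA.submatrix id (Fin.castLE hm)) hj
    have h := mul_sum_sin_principalAngle_le hA hB hZ hAB hrank hm hn ha S
    rw [hS] at h
    rw [hsum, Finset.sum_congr rfl fun k hk => hM k ((Finset.mem_range.1 hk).trans_le hj)]
    linarith

theorem theorem5 {m n r : ℕ} (hr : 1 ≤ r) (A B Z Zr : Matrix (Fin m) (Fin n) ℝ)
    (hA : A.rank = r) (hB : B = A + Z)
    (U Uhat : Matrix (Fin m) (Fin r) ℝ) (V Vhat : Matrix (Fin n) (Fin r) ℝ)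
    (hUV : IsLeadingSingularVectors r A U V)
    (hUVhat : IsLeadingSingularVectors r B Uhat Vhat)
    (hZr : IsTruncatedSVD r Z Zr)
    (q : ℝ≥0∞) (hq : 1 ≤ q) :
    max (schattenNorm q (sinTheta Uhat U)) (schattenNorm q (sinTheta Vhat V)) ≤
      2 * schattenNorm q Zr / matSingularValue A (r - 1) := by
  obtain ⟨hm, hn, PA, QA, hSA, rfl, rfl⟩ := hUV
  obtain ⟨-, -, PB, QB, hSB, rfl, rfl⟩ := hUVhat
  have hM : ∀ k < r, matSingularValue Zr k = matSingularValue Z k :=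
    fun k hk => hZr.matSingularValue_eq hk hn
  obtain ⟨PZ, QZ, hSZ, -⟩ := hZr
  have ha : 0 < matSingularValue A (r - 1) := (matSingularValue_pos_iff A _).2 (by omega)
  refine max_le ?_ ?_
  · exact schattenNorm_sinTheta_le hSA.isSVDWith hSB.isSVDWith hSZ.isSVDWith hB hA.le hr hm hn
      hm hn ha hM hq
  -- `Zr` stays untransposed: it enters only through its first `r` singular values, and its shape is
  -- independent of that of `A`.
  · exact schattenNorm_sinTheta_le hSA.isSVDWith.transpose hSB.isSVDWith.transpose
      hSZ.isSVDWith.transpose (by rw [hB, Matrix.transpose_add])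
      (by rw [Matrix.rank_transpose, hA]) hr hn hm hm hn ha hM hq
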